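/- Let $d\ge 1$ be a natural number. For a bounded convex set $K\subset\mathbb R^d$ with nonempty interior, let $\mathsf V_d(K)$ denote its Lebesgue measure, let $P_1,P_2$ be independent random points uniformly distributed in $K$, and define the elongation of $K$ by $$\lambda_d(K):=3\rho_d\,\frac{\mathbb E\,|P_1P_2|^d}{\mathsf V_d(K)},\qquad \rho_d:=\frac{\pi^{d/2}\,\Gamma(d)}{2^{2d-1}\,\Gamma\!\left(\frac{d+1}2\right)\Gamma\!\left(d+\frac12\right)},$$ where $|P_1P_2|$ is the Euclidean distance between $P_1$ and $P_2$. Then, for every bounded convex set $K\subset\mathbb R^d$ with nonempty interior, the inequality $\lambda_d(K)\le\lambda_d(L)$ holds for all bounded convex sets $L\subset\mathbb R^d$ with nonempty interior if and only if the closure of $K$ is a closed ball of positive radius. In particular, the minimum of $\lambda_d$ over such sets exists, and it is attained at $K$ exactly when the closure of $K$ is a closed ball of positive radius. -/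

import Mathlib

open MeasureTheory ProbabilityTheory

noncomputable section

/-- The bounded convex subsets of `ℝ^d` with nonempty interior. -/
def ConvexBoundedSets (d : ℕ) : Set (Set (EuclideanSpace ℝ (Fin d))) :=
  {K | Convex ℝ K ∧ Bornology.IsBounded K ∧ (interior K).Nonempty}

/-- The uniform distribution on `K`: Lebesgue measure conditioned on `K`. -/
def uniformLaw (d : ℕ) (K : Set (EuclideanSpace ℝ (Fin d))) :
    Measure (EuclideanSpace ℝ (Fin d)) :=
  ProbabilityTheory.cond volume K

/-- `E |P₁P₂|^d` for `P₁`, `P₂` drawn independently and uniformly from `K`. -/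
def meanDistPow (d : ℕ) (K : Set (EuclideanSpace ℝ (Fin d))) : ℝ :=
  ∫ p, dist p.1 p.2 ^ d ∂((uniformLaw d K).prod (uniformLaw d K))

/-- `ρ_d = π^(d/2) Γ(d) / (2^(2d-1) Γ((d+1)/2) Γ(d+1/2))`. -/
def elongationRho (d : ℕ) : ℝ :=
  Real.pi ^ ((d : ℝ) / 2) * Real.Gamma (d : ℝ) /
    ((2 : ℝ) ^ (2 * (d : ℝ) - 1) * Real.Gamma (((d : ℝ) + 1) / 2) * Real.Gamma ((d : ℝ) + 1 / 2))

/-- The elongation `λ_d(K) = 3 ρ_d E|P₁P₂|^d / V_d(K)`. -/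
def elongation (d : ℕ) (K : Set (EuclideanSpace ℝ (Fin d))) : ℝ :=
  3 * elongationRho d * (meanDistPow d K / volume.real K)

end

/-!
Balls minimize the mean `d`-th power of the distance between two uniform points, among sets of
given volume. This is an instance of the Riesz rearrangement inequality; since the kernel
`‖x - y‖ ^ d` is convex, it can be obtained by mass transport, which also yields the equality case.

Let `B` be the centred ball with the volume of `K`. A coupling `π` of the uniform laws of `B` and
`K` is built such that for every `t` in `(0, 1)` the law of `(1 - t) x + t z`, for `(x, z)` drawn
from `π`, has density at most that of the uniform law on `B`. It is the Knothe coupling: one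
coordinate after the other, conditional quantile functions are matched, and the arithmetic-geometric
mean inequality for their derivatives bounds the density (`HasTransportInterpolation`,
`lintegral_quantile_interp_le`).

The potential `u y = ∫ ‖y - w‖ ^ d` over `w` in `B` increases with `‖y‖`, so by the density bound
the mean of `u` along the interpolation is at least its mean over `B`. Hence its derivative at
`t = 0` is nonnegative. That derivative is half of the first variation of the double integral
`∬ ‖x - x'‖ ^ d` along the displacement from `x` to `z`, and convexity of the power then gives
`∬ ‖z - z'‖ ^ d ≥ ∬ ‖x - x'‖ ^ d` (`integral_dist_pow_le_of_coupling`). For `d ≥ 2` the power is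
strictly convex, so equality makes the displacement `z - x` almost surely constant, and `K` is a
translate of `B` up to a null set; a convex set that agrees with a ball up to a null set has that
ball as its closure. For `d = 1` the closure of every admissible set is a ball, and all balls
have the same elongation by scaling.
-/

open Set Filter Topology
open scoped ENNReal NNReal RealInnerProductSpace

/-! ### Quantile functions on the line -/

/-- The quantile function of a probability measure on the line, extended by `0` outside `(0, 1)`. -/
noncomputable def quantile (ν : Measure ℝ) (u : ℝ) : ℝ :=
  open scoped Classical in if u ∈ Ioo (0 : ℝ) 1 then sInf {s | u ≤ cdf ν s} else 0

lemma quantile_le_iff (ν : Measure ℝ) {u : ℝ} (hu : u ∈ Ioo (0 : ℝ) 1) (s : ℝ) :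
    quantile ν u ≤ s ↔ u ≤ cdf ν s := by
  have hne : {s | u ≤ cdf ν s}.Nonempty :=
    (((tendsto_cdf_atTop ν).eventually (lt_mem_nhds hu.2)).mono fun _ h => le_of_lt h).exists
  have hbdd : BddBelow {s | u ≤ cdf ν s} := by
    obtain ⟨a, ha⟩ := ((tendsto_cdf_atBot ν).eventually (gt_mem_nhds hu.1)).exists
    refine ⟨a, fun s hs => ?_⟩
    by_contra! h
    exact absurd (hs.trans (monotone_cdf ν h.le)) (not_le.2 ha)
  rw [quantile, if_pos hu]
  refine ⟨fun h => ?_, fun h => csInf_le hbdd h⟩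
  have hr : Tendsto (cdf ν) (𝓝[>] s) (𝓝 (cdf ν s)) :=
    ((cdf ν).right_continuous s).mono_left (nhdsWithin_mono _ Ioi_subset_Ici_self)
  refine ge_of_tendsto hr ?_
  filter_upwards [self_mem_nhdsWithin] with s' hs'
  obtain ⟨a, ha, has⟩ := exists_lt_of_csInf_lt hne (lt_of_le_of_lt h hs')
  exact le_trans ha (monotone_cdf ν has.le)

lemma monotoneOn_quantile (ν : Measure ℝ) : MonotoneOn (quantile ν) (Ioo 0 1) := by
  intro a ha b hb hab
  rw [quantile_le_iff ν ha]
  exact hab.trans ((quantile_le_iff ν hb _).1 le_rfl)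

/-- Quantiles depend measurably on a parameter as soon as distribution functions do. -/
lemma measurable_quantile {X : Type*} [MeasurableSpace X] {ν : X → Measure ℝ}
    (hν : ∀ s, Measurable fun x => cdf (ν x) s) :
    Measurable fun p : X × ℝ => quantile (ν p.1) p.2 := by
  refine measurable_of_Iic fun s => ?_
  have : (fun p : X × ℝ => quantile (ν p.1) p.2) ⁻¹' Iic s =
      (Prod.snd ⁻¹' Ioo 0 1 ∩ {p | p.2 ≤ cdf (ν p.1) s}) ∪
        ((Prod.snd ⁻¹' Ioo 0 1)ᶜ ∩ {_p | 0 ≤ s}) := by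
    ext p
    by_cases hp : p.2 ∈ Ioo (0 : ℝ) 1
    · simp only [mem_preimage, mem_Iic, quantile_le_iff _ hp]
      simp [hp.1, hp.2]
    · have : quantile (ν p.1) p.2 = 0 := if_neg hp
      simp only [mem_preimage, mem_Iic, this, mem_union, mem_inter_iff, mem_compl_iff, hp,
        mem_ofPred_eq]
      simp
  rw [this]
  have h1 : MeasurableSet (Prod.snd ⁻¹' Ioo (0 : ℝ) 1 : Set (X × ℝ)) :=
    measurable_snd measurableSet_Ioo
  exact (h1.inter (measurableSet_le measurable_snd ((hν s).comp measurable_fst))).union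
    (h1.compl.inter (MeasurableSet.const _))

lemma measurable_quantile_right (ν : Measure ℝ) : Measurable (quantile ν) :=
  (measurable_quantile (X := Unit) (ν := fun _ => ν) fun _ => measurable_const).comp
    (measurable_const (a := ()) |>.prodMk measurable_id)

lemma map_quantile (ν : Measure ℝ) [IsProbabilityMeasure ν] :
    (volume.restrict (Ioo (0 : ℝ) 1)).map (quantile ν) = ν := by
  have : IsProbabilityMeasure (volume.restrict (Ioo (0 : ℝ) 1)) := ⟨by simp⟩
  have := Measure.isProbabilityMeasure_map (μ := volume.restrict (Ioo (0 : ℝ) 1))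
    (measurable_quantile_right ν).aemeasurable
  refine Measure.ext_of_Iic _ _ fun s => ?_
  rw [Measure.map_apply (measurable_quantile_right ν) measurableSet_Iic,
    Measure.restrict_apply (measurable_quantile_right ν measurableSet_Iic), ← ofReal_cdf]
  have h : quantile ν ⁻¹' Iic s ∩ Ioo 0 1 = Iic (cdf ν s) ∩ Ioo 0 1 := by
    ext u
    simp only [mem_inter_iff, mem_preimage, mem_Iic]
    exact and_congr_left fun hu => quantile_le_iff ν hu s
  rw [h]
  have h0 := cdf_nonneg ν s
  have h1 := cdf_le_one ν s
  refine le_antisymm ?_ ?_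
  · refine (measure_mono (t := Ioc 0 (cdf ν s)) fun u hu => ⟨hu.2.1, hu.1⟩).trans ?_
    simp
  · refine le_trans ?_ (measure_mono (s := Ioo 0 (cdf ν s))
      fun u hu => ⟨hu.2.le, hu.1, hu.2.trans_le h1⟩)
    simp

/-- The quantile function inverts the distribution function, so its derivative is the reciprocal
of the density at the quantile. -/
lemma ae_hasDerivAt_quantile {h : ℝ → ℝ≥0} (hm : Measurable h) (h1 : ∫⁻ s, h s = 1) :
    ∀ᵐ u ∂(volume.restrict (Ioo (0 : ℝ) 1)), ∃ q' : ℝ,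
      HasDerivAt (quantile (volume.withDensity fun s => (h s : ℝ≥0∞))) q' u ∧ 0 ≤ q' ∧
      q' * h (quantile (volume.withDensity fun s => (h s : ℝ≥0∞)) u) = 1 := by
  set ν := volume.withDensity fun s => (h s : ℝ≥0∞) with hν
  have hprob : IsProbabilityMeasure ν := ⟨by rw [hν, withDensity_apply _ .univ]; simpa using h1⟩
  have hderiv : ∀ᵐ s, HasDerivAt (cdf ν) (h s) s := by
    have e := (cdf ν).ae_hasDerivAt
    rw [measure_cdf] at e
    filter_upwards [e, Measure.rnDeriv_withDensity volume hm.coe_nnreal_ennreal] with s hs hr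
    rw [← hν] at hr
    rw [hr] at hs
    simpa using hs
  have hac : ν ≪ volume := withDensity_absolutelyContinuous _ _
  have hd' : ∀ᵐ u ∂(volume.restrict (Ioo (0 : ℝ) 1)), HasDerivAt (cdf ν) (h (quantile ν u))
      (quantile ν u) := by
    have hm : (volume.restrict (Ioo (0 : ℝ) 1)).map (quantile ν) ≪ volume :=
      (map_quantile ν).symm ▸ hac
    exact ae_of_ae_map (measurable_quantile_right ν).aemeasurable (hm.ae_le hderiv)
  have hinv : ∀ u ∈ Ioo (0 : ℝ) 1, cdf ν (quantile ν u) = u := by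
    intro u hu
    refine le_antisymm ?_ ((quantile_le_iff ν hu _).1 le_rfl)
    have hatom : ν {quantile ν u} = 0 := hac (by simp)
    nth_rewrite 1 [← measure_cdf ν] at hatom
    rw [StieltjesFunction.measure_singleton, ENNReal.ofReal_eq_zero, sub_nonpos] at hatom
    refine hatom.trans (le_of_tendsto ((cdf ν).mono.tendsto_leftLim _) ?_)
    filter_upwards [self_mem_nhdsWithin] with s hs
    by_contra! hc
    exact absurd ((quantile_le_iff ν hu s).2 hc.le) (not_le.2 hs)
  have hqd : ∀ᵐ u ∂(volume.restrict (Ioo (0 : ℝ) 1)),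
      DifferentiableWithinAt ℝ (quantile ν) (Ioo 0 1) u := by
    rw [ae_restrict_iff' measurableSet_Ioo]
    exact (monotoneOn_quantile ν).ae_differentiableWithinAt_of_mem
  filter_upwards [hd', hqd, ae_restrict_mem measurableSet_Ioo] with u hu hq hmem
  have hn : Ioo (0 : ℝ) 1 ∈ 𝓝 u := isOpen_Ioo.mem_nhds hmem
  have hqa := (hq.differentiableAt hn).hasDerivAt
  refine ⟨_, hqa, ?_, ?_⟩
  · rw [← derivWithin_of_mem_nhds hn]
    exact (monotoneOn_quantile ν).derivWithin_nonneg
  · have hc := hu.comp u hqa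
    have hid : HasDerivAt (cdf ν ∘ quantile ν) 1 u := by
      refine (hasDerivAt_id u).congr_of_eventuallyEq ?_
      filter_upwards [hn] with v hv using hinv v hv
    rw [mul_comm]
    exact hc.unique hid

/-- The one-dimensional transport estimate: interpolating two quantile functions gives a map whose
derivative is at least the geometric mean of the two derivatives, by the inequality of
arithmetic and geometric means. -/
lemma lintegral_quantile_interp_le {h₀ h₁ : ℝ → ℝ≥0} (hm₀ : Measurable h₀) (hm₁ : Measurable h₁)
    (hh₀ : ∫⁻ s, h₀ s = 1) (hh₁ : ∫⁻ s, h₁ s = 1) {t : ℝ} (ht : t ∈ Ioo (0 : ℝ) 1)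
    (φ : ℝ → ℝ≥0∞) :
    let q₀ := quantile (volume.withDensity fun s => (h₀ s : ℝ≥0∞))
    let q₁ := quantile (volume.withDensity fun s => (h₁ s : ℝ≥0∞))
    ∫⁻ u in Ioo (0 : ℝ) 1, φ ((1 - t) * q₀ u + t * q₁ u) *
      ((h₀ (q₀ u) ^ (1 - t) * h₁ (q₁ u) ^ t)⁻¹ : ℝ≥0) ≤ ∫⁻ s, φ s := by
  intro q₀ q₁
  set q : ℝ → ℝ := fun u => (1 - t) * q₀ u + t * q₁ u with hq
  have ht0 : 0 ≤ t := ht.1.le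
  have ht1 : 0 ≤ 1 - t := by linarith [ht.2]
  -- Monotone functions satisfy the change of variables formula where they are differentiable.
  set S : Set ℝ := Ioo 0 1 ∩ {u | DifferentiableAt ℝ q u} with hS
  have hSm : MeasurableSet S := measurableSet_Ioo.inter (measurableSet_of_differentiableAt ℝ q)
  have hmono : MonotoneOn q S := by
    intro a ha b hb hab
    have e0 := monotoneOn_quantile (volume.withDensity fun s => (h₀ s : ℝ≥0∞)) ha.1 hb.1 hab
    have e1 := monotoneOn_quantile (volume.withDensity fun s => (h₁ s : ℝ≥0∞)) ha.1 hb.1 hab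
    exact add_le_add (mul_le_mul_of_nonneg_left e0 ht1) (mul_le_mul_of_nonneg_left e1 ht0)
  have key := lintegral_image_eq_lintegral_deriv_mul_of_monotoneOn hSm
    (fun x hx => (DifferentiableAt.hasDerivAt hx.2).hasDerivWithinAt) hmono φ
  have hae : ∀ᵐ u ∂(volume.restrict (Ioo (0 : ℝ) 1)), u ∈ S ∧
      ((h₀ (q₀ u) ^ (1 - t) * h₁ (q₁ u) ^ t)⁻¹ : ℝ≥0) ≤ ENNReal.ofReal (deriv q u) := by
    filter_upwards [ae_hasDerivAt_quantile hm₀ hh₀, ae_hasDerivAt_quantile hm₁ hh₁,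
      ae_restrict_mem measurableSet_Ioo] with u ⟨a, ha, ha0, hah⟩ ⟨b, hb, hb0, hbh⟩ hu
    have hqd : HasDerivAt q ((1 - t) * a + t * b) u := (ha.const_mul _).add (hb.const_mul _)
    refine ⟨⟨hu, hqd.differentiableAt⟩, ?_⟩
    rw [hqd.deriv]
    change _ ≤ ((Real.toNNReal _ : ℝ≥0) : ℝ≥0∞)
    rw [ENNReal.coe_le_coe, ← NNReal.coe_le_coe, Real.coe_toNNReal _ (by positivity)]
    have ea : a = ((h₀ (q₀ u) : ℝ≥0) : ℝ)⁻¹ := eq_inv_of_mul_eq_one_left hah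
    have eb : b = ((h₁ (q₁ u) : ℝ≥0) : ℝ)⁻¹ := eq_inv_of_mul_eq_one_left hbh
    have := Real.geom_mean_le_arith_mean2_weighted ht1 ht0 ha0 hb0 (by ring)
    refine le_trans (le_of_eq ?_) this
    rw [ea, eb, Real.inv_rpow (by positivity), Real.inv_rpow (by positivity)]
    push_cast
    rw [mul_inv]
  have hSae : (volume.restrict (Ioo (0 : ℝ) 1)) = volume.restrict S := by
    refine Measure.restrict_congr_set ?_
    have := (ae_restrict_iff' measurableSet_Ioo).1 hae
    filter_upwards [this] with u hu
    exact propext ⟨fun h => (hu h).1, fun h => h.1⟩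
  calc _ ≤ ∫⁻ u in Ioo (0 : ℝ) 1, ENNReal.ofReal (deriv q u) * φ (q u) := by
        refine lintegral_mono_ae ?_
        filter_upwards [hae] with u hu
        rw [mul_comm]
        exact mul_le_mul_left hu.2 _
    _ = ∫⁻ x in q '' S, φ x := by rw [hSae, key]
    _ ≤ _ := setLIntegral_le_lintegral _ _

/-! ### The Knothe coupling of two densities -/

/-- Any two probability densities `f`, `g` with respect to `μ` have a coupling `π` whose
interpolants `(1 - t) x + t z` have density at most the geometric mean `f x ^ (1 - t) * g z ^ t`. The bound
is put in weak form: dividing `π` by the geometric mean and pushing forward gives at most `μ`.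
Densities take values in `ℝ≥0`, where inverses are multiplicative without side conditions; the
points where the weight is the junk value `0⁻¹ = 0` are `π`-null. -/
def HasTransportInterpolation {E : Type*} [AddCommGroup E] [Module ℝ E] [MeasurableSpace E]
    (μ : Measure E) : Prop :=
  ∀ f g : E → ℝ≥0, Measurable f → Measurable g → ∫⁻ x, f x ∂μ = 1 → ∫⁻ x, g x ∂μ = 1 →
    ∃ π : Measure (E × E), π.map Prod.fst = μ.withDensity (fun x => f x) ∧
      π.map Prod.snd = μ.withDensity (fun x => g x) ∧
      ∀ t ∈ Ioo (0 : ℝ) 1, ∀ φ : E → ℝ≥0∞, Measurable φ →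
        ∫⁻ p, φ ((1 - t) • p.1 + t • p.2) * ((f p.1 ^ (1 - t) * g p.2 ^ t)⁻¹ : ℝ≥0) ∂π ≤
          ∫⁻ x, φ x ∂μ

/-- Every probability density on `E × ℝ` is a product of its marginal density on `E` and of
conditional densities on the line. -/
lemma exists_conditional_density {E : Type*} [MeasurableSpace E] {μ : Measure E} [SFinite μ]
    {f : E × ℝ → ℝ≥0} (hf : Measurable f) (hf1 : ∫⁻ p, f p ∂(μ.prod volume) = 1) :
    ∃ (F : E → ℝ≥0) (h : E × ℝ → ℝ≥0), Measurable F ∧ Measurable h ∧ ∫⁻ x, F x ∂μ = 1 ∧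
      (∀ x, ∫⁻ s, h (x, s) = 1) ∧ f =ᵐ[μ.prod volume] fun p => F p.1 * h p := by
  set I : E → ℝ≥0∞ := fun x => ∫⁻ s, f (x, s) with hI
  have hIm : Measurable I := hf.coe_nnreal_ennreal.lintegral_prod_right'
  have hI1 : ∫⁻ x, I x ∂μ = 1 := by
    rw [← hf1, lintegral_prod _ hf.coe_nnreal_ennreal.aemeasurable]
  have hfin : ∀ᵐ x ∂μ, I x < ∞ := ae_lt_top hIm (by simp [hI1])
  classical
  -- Off `G` the conditional density is that of the uniform law on the unit interval,
  -- so that every conditional law is a probability measure.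
  set G : Set E := {x | I x ≠ 0 ∧ I x ≠ ∞} with hG
  have hGm : MeasurableSet G :=
    (hIm (measurableSet_singleton 0).compl).inter (hIm (measurableSet_singleton ∞).compl)
  set h : E × ℝ → ℝ≥0 := fun p =>
    if p.1 ∈ G then f p / (I p.1).toNNReal else (Ioo (0 : ℝ) 1).indicator 1 p.2 with hh
  have hhm : Measurable h := by
    refine Measurable.ite (measurable_fst hGm)
      (hf.div (hIm.ennreal_toNNReal.comp measurable_fst)) ?_
    exact (measurable_one.indicator measurableSet_Ioo).comp measurable_snd
  refine ⟨fun x => (I x).toNNReal, h, hIm.ennreal_toNNReal, hhm, ?_, fun x => ?_, ?_⟩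
  · rw [← hI1]
    refine lintegral_congr_ae ?_
    filter_upwards [hfin] with x hx using ENNReal.coe_toNNReal hx.ne
  · by_cases hx : x ∈ G
    · have h0 : (I x).toNNReal ≠ 0 := (ENNReal.toNNReal_ne_zero).2 hx
      simp only [hh, hx, if_true]
      have e (s : ℝ) : ((f (x, s) / (I x).toNNReal : ℝ≥0) : ℝ≥0∞) = f (x, s) * (I x)⁻¹ := by
        rw [ENNReal.coe_div h0, ENNReal.coe_toNNReal hx.2, div_eq_mul_inv]
      simp only [e]
      rw [lintegral_mul_const' _ _ (ENNReal.inv_ne_top.2 hx.1)]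
      exact ENNReal.mul_inv_cancel hx.1 hx.2
    · simp only [hh, hx, if_false]
      have : ∀ s : ℝ, (((Ioo (0 : ℝ) 1).indicator (1 : ℝ → ℝ≥0) s : ℝ≥0) : ℝ≥0∞) =
          (Ioo (0 : ℝ) 1).indicator 1 s := fun s => by
        by_cases hs : s ∈ Ioo (0 : ℝ) 1 <;> simp [hs]
      simp only [this]
      rw [lintegral_indicator_one measurableSet_Ioo]
      simp
  · have hms : MeasurableSet {p : E × ℝ | f p = (I p.1).toNNReal * h p} :=
      measurableSet_eq_fun hf ((hIm.ennreal_toNNReal.comp measurable_fst).mul hhm)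
    refine (Measure.ae_prod_iff_ae_ae hms).2 ?_
    filter_upwards [hfin] with x hx
    by_cases h0 : I x = 0
    · have : (fun s => (f (x, s) : ℝ≥0∞)) =ᵐ[volume] 0 :=
        (lintegral_eq_zero_iff (hf.comp measurable_prodMk_left).coe_nnreal_ennreal).1 h0
      filter_upwards [this] with s hs
      have hs' : f (x, s) = 0 := by simpa using hs
      simp [h0, hs']
    · refine Eventually.of_forall fun s => ?_
      have hxG : x ∈ G := ⟨h0, hx.ne⟩
      have h0' : (I x).toNNReal ≠ 0 := (ENNReal.toNNReal_ne_zero).2 hxG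
      simp only [hh, hxG, if_true]
      exact (mul_div_cancel₀ _ h0').symm

/-- The probability measure on the line given by the conditional density `h (x, ·)`. -/
noncomputable abbrev condLaw {E : Type*} (h : E × ℝ → ℝ≥0) (x : E) : Measure ℝ :=
  volume.withDensity fun s => (h (x, s) : ℝ≥0∞)

lemma isProbabilityMeasure_condLaw {E : Type*} {h : E × ℝ → ℝ≥0}
    (h1 : ∀ x, ∫⁻ s, h (x, s) = 1) (x : E) : IsProbabilityMeasure (condLaw h x) :=
  ⟨by rw [withDensity_apply _ .univ]; simpa using h1 x⟩

lemma measurable_quantile_condLaw {E : Type*} [MeasurableSpace E] {h : E × ℝ → ℝ≥0}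
    (hm : Measurable h) (h1 : ∀ x, ∫⁻ s, h (x, s) = 1) :
    Measurable fun p : E × ℝ => quantile (condLaw h p.1) p.2 := by
  refine measurable_quantile (ν := condLaw h) fun s => ?_
  have (x : E) : cdf (condLaw h x) s = (∫⁻ y in Iic s, h (x, y)).toReal := by
    have := isProbabilityMeasure_condLaw h1 x
    rw [cdf_eq_real, measureReal_def, withDensity_apply _ measurableSet_Iic]
  simp only [this]
  exact hm.coe_nnreal_ennreal.lintegral_prod_right'.ennreal_toReal

/-- Sampling the last coordinate by conditional quantiles from a law with density `F` produces the
law with density `F h`. -/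
lemma map_prodMk_quantile {X E : Type*} [MeasurableSpace X] [MeasurableSpace E] {μ : Measure E}
    [SFinite μ] {π : Measure X} [SFinite π] {p : X → E} (hp : Measurable p) {F : E → ℝ≥0}
    (hF : Measurable F) (hπ : π.map p = μ.withDensity fun x => (F x : ℝ≥0∞))
    {h : E × ℝ → ℝ≥0} (hm : Measurable h) (h1 : ∀ x, ∫⁻ s, h (x, s) = 1) :
    (π.prod (volume.restrict (Ioo (0 : ℝ) 1))).map
        (fun w => (p w.1, quantile (condLaw h (p w.1)) w.2)) =
      (μ.prod volume).withDensity fun w => ((F w.1 * h w : ℝ≥0) : ℝ≥0∞) := by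
  have hq := measurable_quantile_condLaw hm h1
  have hΨ : Measurable fun w : X × ℝ => (p w.1, quantile (condLaw h (p w.1)) w.2) :=
    (hp.comp measurable_fst).prodMk
      (hq.comp ((hp.comp measurable_fst).prodMk measurable_snd))
  refine Measure.ext_of_lintegral _ fun φ hφ => ?_
  have hφh : Measurable fun w : E × ℝ => (h w : ℝ≥0∞) * φ w := hm.coe_nnreal_ennreal.mul hφ
  have inner (x : E) : ∫⁻ u in Ioo (0 : ℝ) 1, φ (x, quantile (condLaw h x) u) =
      ∫⁻ s, h (x, s) * φ (x, s) := by
    have := isProbabilityMeasure_condLaw h1 x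
    rw [← lintegral_map (f := fun s => φ (x, s)) (hφ.comp measurable_prodMk_left)
      (measurable_quantile_right _), map_quantile]
    exact lintegral_withDensity_eq_lintegral_mul _
      (hm.comp measurable_prodMk_left).coe_nnreal_ennreal (hφ.comp measurable_prodMk_left)
  have hFh : Measurable fun w : E × ℝ => ((F w.1 * h w : ℝ≥0) : ℝ≥0∞) :=
    ((hF.comp measurable_fst).mul hm).coe_nnreal_ennreal
  have hin : Measurable fun x => ∫⁻ s, h (x, s) * φ (x, s) := hφh.lintegral_prod_right'
  rw [lintegral_map hφ hΨ,
    lintegral_prod (fun w : X × ℝ => φ (p w.1, quantile (condLaw h (p w.1)) w.2))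
    (hφ.comp hΨ).aemeasurable]
  simp only [inner]
  rw [← lintegral_map (f := fun x => ∫⁻ s, h (x, s) * φ (x, s)) hin hp, hπ,
    lintegral_withDensity_eq_lintegral_mul _ hF.coe_nnreal_ennreal hin,
    lintegral_withDensity_eq_lintegral_mul _ hFh hφ,
    lintegral_prod _ (hFh.mul hφ).aemeasurable]
  refine lintegral_congr fun x => ?_
  simp only [Pi.mul_apply, ENNReal.coe_mul, mul_assoc]
  rw [lintegral_const_mul' _ _ ENNReal.coe_ne_top]

/-- The inductive step of the Knothe construction: the marginals on `E` are coupled first, and then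
the last coordinates by the quantile functions of the two conditional laws at one common level. -/
lemma HasTransportInterpolation.prod_real {E : Type*} [AddCommGroup E] [Module ℝ E]
    [MeasurableSpace E] [MeasurableAdd₂ E] [MeasurableConstSMul ℝ E] {μ : Measure E} [SFinite μ]
    (hμ : HasTransportInterpolation μ) :
    HasTransportInterpolation (μ.prod (volume : Measure ℝ)) := by
  intro f g hf hg hf1 hg1
  obtain ⟨F₀, h₀, hF₀, hh₀, hF₀1, hh₀1, hfe⟩ := exists_conditional_density hf hf1
  obtain ⟨F₁, h₁, hF₁, hh₁, hF₁1, hh₁1, hge⟩ := exists_conditional_density hg hg1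
  obtain ⟨π, hπ0, hπ1, hπ⟩ := hμ F₀ F₁ hF₀ hF₁ hF₀1 hF₁1
  have hfin : IsFiniteMeasure π := by
    refine ⟨?_⟩
    have : π univ = (π.map Prod.fst) univ := by
      rw [Measure.map_apply measurable_fst .univ]; simp
    rw [this, hπ0, withDensity_apply _ .univ, Measure.restrict_univ, hF₀1]
    exact ENNReal.one_lt_top
  have hq0 := measurable_quantile_condLaw hh₀ hh₀1
  have hq1 := measurable_quantile_condLaw hh₁ hh₁1
  set U : Measure ℝ := volume.restrict (Ioo (0 : ℝ) 1) with hU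
  set Ψ₀ : (E × E) × ℝ → E × ℝ := fun w => (w.1.1, quantile (condLaw h₀ w.1.1) w.2) with hΨ₀
  set Ψ₁ : (E × E) × ℝ → E × ℝ := fun w => (w.1.2, quantile (condLaw h₁ w.1.2) w.2) with hΨ₁
  have hm0 : Measurable Ψ₀ := by
    have hw : Measurable fun w : (E × E) × ℝ => (w.1.1, w.2) := by fun_prop
    exact Measurable.prodMk (by fun_prop) (hq0.comp hw)
  have hm1 : Measurable Ψ₁ := by
    have hw : Measurable fun w : (E × E) × ℝ => (w.1.2, w.2) := by fun_prop
    exact Measurable.prodMk (by fun_prop) (hq1.comp hw)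
  have hmap0 : (π.prod U).map Ψ₀ = (μ.prod volume).withDensity fun w => (f w : ℝ≥0∞) := by
    rw [map_prodMk_quantile measurable_fst hF₀ hπ0 hh₀ hh₀1]
    refine withDensity_congr_ae ?_
    filter_upwards [hfe] with w hw
    rw [hw]
  have hmap1 : (π.prod U).map Ψ₁ = (μ.prod volume).withDensity fun w => (g w : ℝ≥0∞) := by
    rw [map_prodMk_quantile measurable_snd hF₁ hπ1 hh₁ hh₁1]
    refine withDensity_congr_ae ?_
    filter_upwards [hge] with w hw
    rw [hw]
  have hfe' : ∀ᵐ w ∂(π.prod U), f (Ψ₀ w) = F₀ w.1.1 * h₀ (Ψ₀ w) := by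
    have : (π.prod U).map Ψ₀ ≪ μ.prod volume := hmap0 ▸ withDensity_absolutelyContinuous _ _
    exact ae_of_ae_map hm0.aemeasurable (this.ae_le hfe)
  have hge' : ∀ᵐ w ∂(π.prod U), g (Ψ₁ w) = F₁ w.1.2 * h₁ (Ψ₁ w) := by
    have : (π.prod U).map Ψ₁ ≪ μ.prod volume := hmap1 ▸ withDensity_absolutelyContinuous _ _
    exact ae_of_ae_map hm1.aemeasurable (this.ae_le hge)
  have hm : Measurable fun w => (Ψ₀ w, Ψ₁ w) := hm0.prodMk hm1
  refine ⟨(π.prod U).map fun w => (Ψ₀ w, Ψ₁ w), ?_, ?_, fun t ht φ hφ => ?_⟩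
  · rw [Measure.map_map measurable_fst hm]; exact hmap0
  · rw [Measure.map_map measurable_snd hm]; exact hmap1
  have hinterp : Measurable fun p : (E × ℝ) × (E × ℝ) => (1 - t) • p.1 + t • p.2 := by
    change Measurable fun p : (E × ℝ) × (E × ℝ) =>
      ((1 - t) • p.1.1 + t • p.2.1, (1 - t) • p.1.2 + t • p.2.2)
    fun_prop
  have hmw : Measurable fun p : (E × ℝ) × (E × ℝ) => φ ((1 - t) • p.1 + t • p.2) *
      ((f p.1 ^ (1 - t) * g p.2 ^ t)⁻¹ : ℝ≥0) := by
    refine (hφ.comp hinterp).mul (Measurable.coe_nnreal_ennreal ?_)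
    fun_prop
  rw [lintegral_map hmw hm]
  have hmw' : Measurable fun w => φ ((1 - t) • Ψ₀ w + t • Ψ₁ w) *
      (((F₀ w.1.1 * h₀ (Ψ₀ w)) ^ (1 - t) * (F₁ w.1.2 * h₁ (Ψ₁ w)) ^ t)⁻¹ : ℝ≥0) := by
    refine ((hφ.comp hinterp).comp hm).mul (Measurable.coe_nnreal_ennreal ?_)
    have := hh₀.comp hm0
    have := hh₁.comp hm1
    fun_prop
  have hφi : Measurable fun x => ∫⁻ s, φ (x, s) := hφ.lintegral_prod_right'
  calc _ = ∫⁻ w, φ ((1 - t) • Ψ₀ w + t • Ψ₁ w) *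
      (((F₀ w.1.1 * h₀ (Ψ₀ w)) ^ (1 - t) * (F₁ w.1.2 * h₁ (Ψ₁ w)) ^ t)⁻¹ : ℝ≥0) ∂(π.prod U) := by
        refine lintegral_congr_ae ?_
        filter_upwards [hfe', hge'] with w h0 h1
        rw [h0, h1]
    _ = ∫⁻ p, ∫⁻ u, φ ((1 - t) • Ψ₀ (p, u) + t • Ψ₁ (p, u)) *
      (((F₀ p.1 * h₀ (Ψ₀ (p, u))) ^ (1 - t) * (F₁ p.2 * h₁ (Ψ₁ (p, u))) ^ t)⁻¹ : ℝ≥0) ∂U ∂π :=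
        lintegral_prod _ hmw'.aemeasurable
    _ ≤ ∫⁻ p, (∫⁻ s, φ ((1 - t) • p.1 + t • p.2, s)) *
          ((F₀ p.1 ^ (1 - t) * F₁ p.2 ^ t)⁻¹ : ℝ≥0) ∂π := by
        refine lintegral_mono fun p => ?_
        have := lintegral_quantile_interp_le (hh₀.comp measurable_prodMk_left)
          (hh₁.comp measurable_prodMk_left) (hh₀1 p.1) (hh₁1 p.2) ht
          (fun s => φ ((1 - t) • p.1 + t • p.2, s))
        refine le_trans (le_of_eq ?_) (mul_le_mul_left this _)
        rw [← lintegral_mul_const' _ _ ENNReal.coe_ne_top]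
        refine lintegral_congr fun u => ?_
        rw [mul_assoc, ← ENNReal.coe_mul, ← mul_inv, NNReal.mul_rpow, NNReal.mul_rpow]
        congr 3
        simp only [hΨ₀, hΨ₁, Function.comp]
        ring
    _ ≤ ∫⁻ x, (∫⁻ s, φ (x, s)) ∂μ := hπ t ht _ hφi
    _ = _ := (lintegral_prod _ hφ.aemeasurable).symm

lemma HasTransportInterpolation.of_measurePreserving {E G : Type*} [AddCommGroup E] [Module ℝ E]
    [MeasurableSpace E] [MeasurableAdd₂ E] [MeasurableConstSMul ℝ E]
    [AddCommGroup G] [Module ℝ G] [MeasurableSpace G]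
    [MeasurableAdd₂ G] [MeasurableConstSMul ℝ G] {μ : Measure E} {ν : Measure G}
    (hμ : HasTransportInterpolation μ) (e : E →ₗ[ℝ] G) (he : MeasurePreserving e μ ν) :
    HasTransportInterpolation ν := by
  intro f g hf hg hf1 hg1
  have hem := he.measurable
  obtain ⟨π, hπ0, hπ1, hπ⟩ := hμ (f ∘ e) (g ∘ e) (hf.comp hem) (hg.comp hem)
    ((he.lintegral_comp hf.coe_nnreal_ennreal).trans hf1)
    ((he.lintegral_comp hg.coe_nnreal_ennreal).trans hg1)
  have hmm : Measurable (Prod.map e e) := hem.prodMap hem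
  have key {k : G → ℝ≥0} (hk : Measurable k) :
      (μ.withDensity fun x => ((k ∘ e) x : ℝ≥0∞)).map e = ν.withDensity fun x => (k x : ℝ≥0∞) := by
    ext s hs
    rw [Measure.map_apply hem hs, withDensity_apply _ (hem hs), withDensity_apply _ hs]
    exact he.setLIntegral_comp_preimage hs hk.coe_nnreal_ennreal
  refine ⟨π.map (Prod.map e e), ?_, ?_, fun t ht φ hφ => ?_⟩
  · rw [Measure.map_map measurable_fst hmm, ← key hf, ← hπ0, Measure.map_map hem measurable_fst]
    rfl
  · rw [Measure.map_map measurable_snd hmm, ← key hg, ← hπ1, Measure.map_map hem measurable_snd]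
    rfl
  · have hmw : Measurable fun p : G × G => φ ((1 - t) • p.1 + t • p.2) *
        ((f p.1 ^ (1 - t) * g p.2 ^ t)⁻¹ : ℝ≥0) := by
      refine (hφ.comp (by fun_prop)).mul (Measurable.coe_nnreal_ennreal ?_)
      fun_prop
    rw [lintegral_map hmw hmm, ← he.lintegral_comp hφ]
    refine le_trans (le_of_eq ?_) (hπ t ht _ (hφ.comp hem))
    refine lintegral_congr fun p => ?_
    simp [Prod.map]

lemma hasTransportInterpolation_pi (n : ℕ) :
    HasTransportInterpolation (volume : Measure (Fin n → ℝ)) := by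
  induction n with
  | zero =>
    intro f g hf hg hf1 hg1
    have hvol : (volume : Measure (Fin 0 → ℝ)) = Measure.dirac 0 :=
      Measure.volume_pi_eq_dirac 0
    have hfg {k : (Fin 0 → ℝ) → ℝ≥0} (hk : ∫⁻ x, k x = 1) : k = 1 := by
      funext x
      rw [hvol, lintegral_dirac, ENNReal.coe_eq_one] at hk
      rw [Subsingleton.elim x 0, hk, Pi.one_apply]
    rw [hfg hf1, hfg hg1]
    refine ⟨Measure.dirac 0, ?_, ?_, fun t ht φ hφ => ?_⟩
    · rw [Measure.map_dirac' measurable_fst, hvol]; simp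
    · rw [Measure.map_dirac' measurable_snd, hvol]; simp
    · rw [lintegral_dirac, hvol, lintegral_dirac]; simp
  | succ n ih =>
    let e : (Fin n → ℝ) × ℝ →ₗ[ℝ] (Fin (n + 1) → ℝ) :=
      { toFun := fun p => Fin.cons p.2 p.1
        map_add' := fun p q => by ext i; cases i using Fin.cases <;> simp
        map_smul' := fun c p => by ext i; cases i using Fin.cases <;> simp }
    refine ih.prod_real.of_measurePreserving e ?_
    have h1 := (volume_preserving_piFinSuccAbove (fun _ : Fin (n + 1) => ℝ) 0).symm
    have h2 : MeasurePreserving (Prod.swap : (Fin n → ℝ) × ℝ → ℝ × (Fin n → ℝ)) :=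
      Measure.measurePreserving_swap
    have h3 := h1.comp h2
    have he : (e : (Fin n → ℝ) × ℝ → Fin (n + 1) → ℝ) =
        (MeasurableEquiv.piFinSuccAbove (fun _ : Fin (n + 1) => ℝ) 0).symm ∘ Prod.swap := by
      ext p i
      cases i using Fin.cases <;> simp [e]
    rw [he]
    exact h3

theorem hasTransportInterpolation_euclideanSpace (d : ℕ) :
    HasTransportInterpolation (volume : Measure (EuclideanSpace ℝ (Fin d))) :=
  (hasTransportInterpolation_pi d).of_measurePreserving
    (WithLp.linearEquiv 2 ℝ (Fin d → ℝ)).symm.toLinearMap (PiLp.volume_preserving_toLp (Fin d))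

/-! ### Convexity of powers of the norm and the first variation -/

/-- The power function lies above its tangents. -/
lemma pow_tangent_le (k : ℕ) {α β : ℝ} (hα : 0 ≤ α) (hβ : 0 ≤ β) :
    α ^ (k + 1) + (k + 1) * α ^ k * (β - α) ≤ β ^ (k + 1) := by
  induction k with
  | zero => simp
  | succ k ih =>
    have e : β ^ (k + 1 + 1) - (α ^ (k + 1 + 1) + ((k + 1 : ℕ) + 1) * α ^ (k + 1) * (β - α)) =
        β * (β ^ (k + 1) - (α ^ (k + 1) + (k + 1) * α ^ k * (β - α))) +
          (k + 1) * α ^ k * (β - α) ^ 2 := by push_cast; ring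
    have h1 := mul_nonneg hβ (sub_nonneg.2 ih)
    have h2 : 0 ≤ (k + 1) * α ^ k * (β - α) ^ 2 := by positivity
    linarith

lemma eq_of_pow_tangent_eq (k : ℕ) {α β : ℝ} (hα : 0 ≤ α) (hβ : 0 ≤ β)
    (h : α ^ (k + 2) + (k + 2) * α ^ (k + 1) * (β - α) = β ^ (k + 2)) : α = β := by
  have e : β ^ (k + 2) - (α ^ (k + 2) + (k + 2) * α ^ (k + 1) * (β - α)) =
      β * (β ^ (k + 1) - (α ^ (k + 1) + (k + 1) * α ^ k * (β - α))) +
        (k + 1) * α ^ k * (β - α) ^ 2 := by ring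
  have h1 := mul_nonneg hβ (sub_nonneg.2 (pow_tangent_le k hα hβ))
  have h2 : 0 ≤ (k + 1) * α ^ k * (β - α) ^ 2 := by positivity
  have h3 : (k + 1) * α ^ k * (β - α) ^ 2 = 0 := by linarith
  rcases hα.eq_or_lt with h0 | h0
  · subst h0
    simp at h
    exact (pow_eq_zero_iff (by omega)).1 h.symm |>.symm
  · have : (k + 1) * α ^ k ≠ 0 := by positivity
    have := pow_eq_zero_iff (two_ne_zero) |>.1 ((mul_eq_zero.1 h3).resolve_left this)
    linarith

section Tangent
variable {E : Type*} [NormedAddCommGroup E] [InnerProductSpace ℝ E]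

/-- A power of the norm with exponent at least two lies above its tangents. -/
lemma norm_pow_tangent_le (k : ℕ) (a b : E) :
    ‖a‖ ^ (k + 2) + (k + 2) * ‖a‖ ^ k * ⟪a, b - a⟫ ≤ ‖b‖ ^ (k + 2) := by
  have h := pow_tangent_le (k + 1) (norm_nonneg a) (norm_nonneg b)
  refine le_trans ?_ h
  have hi : ⟪a, b - a⟫ ≤ ‖a‖ * (‖b‖ - ‖a‖) := by
    rw [inner_sub_right, real_inner_self_eq_norm_sq]
    nlinarith [real_inner_le_norm a b]
  have h0 : 0 ≤ (k + 2) * ‖a‖ ^ k := by positivity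
  have := mul_le_mul_of_nonneg_left hi h0
  push_cast
  calc _ ≤ ‖a‖ ^ (k + 2) + (k + 2) * ‖a‖ ^ k * (‖a‖ * (‖b‖ - ‖a‖)) := by linarith
    _ = _ := by ring

/-- A power of the norm with exponent at least two is strictly convex: it meets a tangent only at
the point of contact. -/
lemma eq_of_norm_pow_tangent_eq (k : ℕ) {a b : E}
    (h : ‖a‖ ^ (k + 2) + (k + 2) * ‖a‖ ^ k * ⟪a, b - a⟫ = ‖b‖ ^ (k + 2)) : a = b := by
  have h1 := pow_tangent_le (k + 1) (norm_nonneg a) (norm_nonneg b)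
  have hi : ⟪a, b - a⟫ ≤ ‖a‖ * (‖b‖ - ‖a‖) := by
    rw [inner_sub_right, real_inner_self_eq_norm_sq]
    nlinarith [real_inner_le_norm a b]
  have h0 : 0 ≤ (k + 2) * ‖a‖ ^ k := by positivity
  have h2 := mul_le_mul_of_nonneg_left hi h0
  push_cast at h1
  have e : (k + 2) * ‖a‖ ^ k * (‖a‖ * (‖b‖ - ‖a‖)) = (k + 2) * ‖a‖ ^ (k + 1) * (‖b‖ - ‖a‖) := by
    ring
  have h1' : ‖a‖ ^ (k + 2) + (k + 2) * ‖a‖ ^ (k + 1) * (‖b‖ - ‖a‖) ≤ ‖b‖ ^ (k + 2) := by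
    refine le_trans (le_of_eq ?_) h1
    ring
  have hn : ‖a‖ = ‖b‖ :=
    eq_of_pow_tangent_eq k (norm_nonneg a) (norm_nonneg b) (le_antisymm h1' (by linarith))
  rcases (norm_nonneg a).eq_or_lt with ha | ha
  · rw [norm_eq_zero.1 ha.symm, norm_eq_zero.1 (hn.symm.trans ha.symm)]
  · have h3 : (k + 2) * ‖a‖ ^ k * ⟪a, b - a⟫ = 0 := by rw [hn] at h ⊢; linarith
    have hpos : (k + 2 : ℝ) * ‖a‖ ^ k ≠ 0 := by positivity
    have h4 := (mul_eq_zero.1 h3).resolve_left hpos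
    rw [inner_sub_right, real_inner_self_eq_norm_sq, sub_eq_zero] at h4
    have h5 : ‖a - b‖ ^ 2 = 0 := by rw [norm_sub_sq_real, h4, hn]; ring
    exact sub_eq_zero.1 (norm_eq_zero.1 (pow_eq_zero_iff two_ne_zero |>.1 h5))

end Tangent

/-- Bathtub principle: let `μ` be a probability measure carried by `B`. Among the probability
measures that are at most `μ` on `B`, the measure `μ` itself gives the least mean to a function whose values
on `B` are below its values off `B`. -/
lemma integral_le_of_restrict_le {E : Type*} [MeasurableSpace E] {μ ν : Measure E}
    [IsProbabilityMeasure μ] [IsProbabilityMeasure ν] {B : Set E} (hB : MeasurableSet B)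
    (hμB : ∀ᵐ x ∂μ, x ∈ B) (hle : ν.restrict B ≤ μ) {u : E → ℝ} (hu : Integrable u μ)
    (hv : Integrable u ν) {c : ℝ} (hin : ∀ x ∈ B, u x ≤ c) (hout : ∀ x ∉ B, c ≤ u x) :
    ∫ x, u x ∂μ ≤ ∫ x, u x ∂ν := by
  have i1 : Integrable (fun x => c - u x) μ := (integrable_const c).sub hu
  have i2 : Integrable (fun x => c - u x) ν := (integrable_const c).sub hv
  have h1 : ∫ x in B, (c - u x) ∂ν ≤ ∫ x, (c - u x) ∂μ :=
    integral_mono_measure hle (hμB.mono fun x hx => sub_nonneg.2 (hin x hx)) i1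
  have h2 : ∫ x in Bᶜ, (c - u x) ∂ν ≤ 0 :=
    setIntegral_nonpos hB.compl fun x hx => sub_nonpos.2 (hout x hx)
  have h3 := integral_add_compl hB i2
  rw [integral_sub (integrable_const c) hu] at h1
  rw [integral_sub (integrable_const c) hv] at h3
  simp only [integral_const, probReal_univ, one_smul] at h1 h3
  linarith

section Coupling
variable {E : Type*} [NormedAddCommGroup E] [InnerProductSpace ℝ E] [FiniteDimensional ℝ E]
  [MeasurableSpace E] [BorelSpace E]

lemma integrable_of_continuous_of_bounded {W : Type*} [NormedAddCommGroup W] [ProperSpace W]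
    [MeasurableSpace W] [OpensMeasurableSpace W] {P : Measure W} [IsFiniteMeasure P] {M : ℝ}
    (hM : ∀ᵐ w ∂P, ‖w‖ ≤ M) {G : W → ℝ} (hG : Continuous G) : Integrable G P := by
  obtain ⟨C, hC⟩ := (isCompact_closedBall (0 : W) M).exists_bound_of_continuousOn hG.continuousOn
  refine Integrable.of_bound hG.aestronglyMeasurable C ?_
  filter_upwards [hM] with w hw using hC w (by simpa using hw)

/-- The first variation argument. If moving one of two independent points along the coupling does
not decrease the mean power of the distance, then transporting both points does not
decrease it either, because the power is convex; strict convexity settles equality. -/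
lemma integral_dist_pow_le_of_coupling (k : ℕ) {π : Measure (E × E)} [IsProbabilityMeasure π]
    {M : ℝ} (hM : ∀ᵐ p ∂π, ‖p‖ ≤ M)
    (H : ∀ t ∈ Ioo (0 : ℝ) 1, ∫ w, ‖w.1.1 - w.2.1‖ ^ (k + 2) ∂(π.prod π) ≤
      ∫ w, ‖((1 - t) • w.1.1 + t • w.1.2) - w.2.1‖ ^ (k + 2) ∂(π.prod π)) :
    ∫ w, ‖w.1.1 - w.2.1‖ ^ (k + 2) ∂(π.prod π) ≤
      ∫ w, ‖w.1.2 - w.2.2‖ ^ (k + 2) ∂(π.prod π) ∧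
    (∫ w, ‖w.1.1 - w.2.1‖ ^ (k + 2) ∂(π.prod π) =
      ∫ w, ‖w.1.2 - w.2.2‖ ^ (k + 2) ∂(π.prod π) →
      ∀ᵐ w ∂(π.prod π), w.1.1 - w.2.1 = w.1.2 - w.2.2) := by
  have hMP : ∀ᵐ w ∂(π.prod π), ‖w‖ ≤ M := by
    filter_upwards [Measure.quasiMeasurePreserving_fst.ae hM,
      Measure.quasiMeasurePreserving_snd.ae hM] with w h1 h2
    exact max_le h1 h2
  have hint {G : (E × E) × (E × E) → ℝ} (hG : Continuous G) : Integrable G (π.prod π) :=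
    integrable_of_continuous_of_bounded hMP hG
  set A : ℝ → (E × E) × (E × E) → ℝ := fun t w =>
    (k + 2) * ‖((1 - t) • w.1.1 + t • w.1.2) - w.2.1‖ ^ k *
      ⟪((1 - t) • w.1.1 + t • w.1.2) - w.2.1, w.1.2 - w.1.1⟫ with hA
  have hAc : Continuous fun q : ℝ × ((E × E) × (E × E)) => A q.1 q.2 := by
    simp only [hA]; fun_prop
  have hAt (t : ℝ) : Continuous (A t) := hAc.comp (by fun_prop : Continuous fun w => (t, w))
  -- By convexity, `t * A t` dominates the increment caused by moving the first point.
  have hApos : ∀ t ∈ Ioo (0 : ℝ) 1, 0 ≤ ∫ w, A t w ∂(π.prod π) := by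
    intro t ht
    have c1 : Continuous fun w : (E × E) × (E × E) =>
      ‖((1 - t) • w.1.1 + t • w.1.2) - w.2.1‖ ^ (k + 2) := by fun_prop
    have c2 : Continuous fun w : (E × E) × (E × E) => ‖w.1.1 - w.2.1‖ ^ (k + 2) := by fun_prop
    have h1 : ∫ w, (‖((1 - t) • w.1.1 + t • w.1.2) - w.2.1‖ ^ (k + 2) -
        ‖w.1.1 - w.2.1‖ ^ (k + 2)) ∂(π.prod π) ≤ ∫ w, t * A t w ∂(π.prod π) := by
      refine integral_mono ((hint c1).sub (hint c2)) ((hint (hAt t)).const_mul t) fun w => ?_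
      have := norm_pow_tangent_le k (((1 - t) • w.1.1 + t • w.1.2) - w.2.1) (w.1.1 - w.2.1)
      have e : (w.1.1 - w.2.1) - (((1 - t) • w.1.1 + t • w.1.2) - w.2.1) =
          (-t) • (w.1.2 - w.1.1) := by module
      rw [e, inner_smul_right] at this
      simp only [hA]
      linarith
    rw [integral_sub (hint c1) (hint c2), integral_const_mul] at h1
    have h2 := H t ht
    exact nonneg_of_mul_nonneg_right (by linarith) ht.1
  have hA0 : 0 ≤ ∫ w, A 0 w ∂(π.prod π) := by
    have hlim : Tendsto (fun t => ∫ w, A t w ∂(π.prod π)) (𝓝[>] 0)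
        (𝓝 (∫ w, A 0 w ∂(π.prod π))) := by
      obtain ⟨C, hC⟩ := ((isCompact_Icc (a := (0 : ℝ)) (b := 1)).prod
        (isCompact_closedBall (0 : (E × E) × (E × E)) M)).exists_bound_of_continuousOn
        hAc.continuousOn
      refine tendsto_integral_filter_of_dominated_convergence (fun _ => C)
        (Eventually.of_forall fun t => (hAt t).aestronglyMeasurable) ?_ (integrable_const C) ?_
      · filter_upwards [Ioo_mem_nhdsGT (zero_lt_one' ℝ)] with t ht
        filter_upwards [hMP] with w hw
        exact hC (t, w) ⟨⟨ht.1.le, ht.2.le⟩, by simpa using hw⟩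
      · refine Eventually.of_forall fun w => ?_
        have : Continuous fun t => A t w := hAc.comp (by fun_prop : Continuous fun t => (t, w))
        exact (this.tendsto 0).mono_left nhdsWithin_le_nhds
    refine ge_of_tendsto hlim ?_
    filter_upwards [Ioo_mem_nhdsGT (zero_lt_one' ℝ)] with t ht using hApos t ht
  have hswap : ∫ w, A 0 w.swap ∂(π.prod π) = ∫ w, A 0 w ∂(π.prod π) :=
    integral_prod_swap (A 0)
  have hAs : Continuous fun w : (E × E) × (E × E) => A 0 w.swap :=
    (hAt 0).comp continuous_swap
  have c1 : Continuous fun w : (E × E) × (E × E) => ‖w.1.1 - w.2.1‖ ^ (k + 2) := by fun_prop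
  have c2 : Continuous fun w : (E × E) × (E × E) => ‖w.1.2 - w.2.2‖ ^ (k + 2) := by fun_prop
  have tangent_eq (w : (E × E) × (E × E)) :
      (k + 2) * ‖w.1.1 - w.2.1‖ ^ k * ⟪w.1.1 - w.2.1, (w.1.2 - w.2.2) - (w.1.1 - w.2.1)⟫ =
        A 0 w + A 0 w.swap := by
    have e1 : (w.1.2 - w.2.2) - (w.1.1 - w.2.1) = (w.1.2 - w.1.1) - (w.2.2 - w.2.1) := by abel
    have e2 : ⟪w.2.1 - w.1.1, w.2.2 - w.2.1⟫ = - ⟪w.1.1 - w.2.1, w.2.2 - w.2.1⟫ := by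
      rw [← neg_sub, inner_neg_left]
    simp only [hA, sub_zero, one_smul, zero_smul, add_zero, Prod.fst_swap, Prod.snd_swap]
    rw [e1, inner_sub_right, e2, norm_sub_rev w.2.1]
    ring
  -- The first order Taylor remainder of the power at `x - x'`, nonnegative by convexity.
  set R : (E × E) × (E × E) → ℝ := fun w => ‖w.1.2 - w.2.2‖ ^ (k + 2) -
    ‖w.1.1 - w.2.1‖ ^ (k + 2) - (A 0 w + A 0 w.swap) with hR
  have hR0 (w : (E × E) × (E × E)) : 0 ≤ R w := by
    have := norm_pow_tangent_le k (w.1.1 - w.2.1) (w.1.2 - w.2.2)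
    rw [tangent_eq] at this
    simp only [hR]; linarith
  have hRi : Integrable R (π.prod π) := hint ((c2.sub c1).sub ((hAt 0).add hAs))
  have hRint : ∫ w, R w ∂(π.prod π) = ∫ w, ‖w.1.2 - w.2.2‖ ^ (k + 2) ∂(π.prod π) -
      ∫ w, ‖w.1.1 - w.2.1‖ ^ (k + 2) ∂(π.prod π) - 2 * ∫ w, A 0 w ∂(π.prod π) := by
    have i1 : Integrable (fun w : (E × E) × (E × E) =>
      ‖w.1.2 - w.2.2‖ ^ (k + 2) - ‖w.1.1 - w.2.1‖ ^ (k + 2)) (π.prod π) := hint (c2.sub c1)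
    have i2 : Integrable (fun w => A 0 w + A 0 w.swap) (π.prod π) := hint ((hAt 0).add hAs)
    simp only [hR]
    rw [integral_sub i1 i2,
      integral_sub (hint c2) (hint c1), integral_add (hint (hAt 0)) (hint hAs), hswap]
    ring
  have hRn : 0 ≤ ∫ w, R w ∂(π.prod π) := integral_nonneg hR0
  refine ⟨by linarith, fun heq => ?_⟩
  have hz : ∫ w, R w ∂(π.prod π) = 0 := by linarith
  filter_upwards [(integral_eq_zero_iff_of_nonneg hR0 hRi).1 hz] with w hw
  refine eq_of_norm_pow_tangent_eq k ?_
  rw [tangent_eq]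
  simp only [hR, Pi.zero_apply] at hw
  linarith

end Coupling

/-! ### Uniform laws and rearrangement -/

section UniformLaw
variable {d : ℕ}

lemma isProbabilityMeasure_uniformLaw {A : Set (EuclideanSpace ℝ (Fin d))} (h0 : volume A ≠ 0)
    (h1 : volume A ≠ ∞) : IsProbabilityMeasure (uniformLaw d A) :=
  cond_isProbabilityMeasure_of_finite h0 h1

lemma uniformLaw_congr {A C : Set (EuclideanSpace ℝ (Fin d))} (h : A =ᵐ[volume] C) :
    uniformLaw d A = uniformLaw d C := by
  simp only [uniformLaw, ProbabilityTheory.cond, measure_congr h, Measure.restrict_congr_set h]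

lemma elongation_congr {A C : Set (EuclideanSpace ℝ (Fin d))} (h : A =ᵐ[volume] C) :
    elongation d A = elongation d C := by
  simp only [elongation, meanDistPow, uniformLaw_congr h, measureReal_def, measure_congr h]

lemma ae_mem_uniformLaw {A : Set (EuclideanSpace ℝ (Fin d))} (hA : MeasurableSet A) :
    ∀ᵐ x ∂(uniformLaw d A), x ∈ A :=
  Measure.ae_smul_measure (ae_restrict_mem hA) _

/-- Two sets of equal volume are coupled so that the interpolated points never concentrate more
than the uniform laws do. -/
lemma exists_coupling_uniformLaw {A C : Set (EuclideanSpace ℝ (Fin d))} (hA : MeasurableSet A)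
    (hC : MeasurableSet C) (hAC : volume A = volume C) (h0 : volume A ≠ 0) (h1 : volume A ≠ ∞) :
    ∃ π : Measure (EuclideanSpace ℝ (Fin d) × EuclideanSpace ℝ (Fin d)),
      IsProbabilityMeasure π ∧ π.map Prod.fst = uniformLaw d A ∧ π.map Prod.snd = uniformLaw d C ∧
      ∀ t ∈ Ioo (0 : ℝ) 1,
        π.map (fun p => (1 - t) • p.1 + t • p.2) ≤ (volume A)⁻¹ • volume := by
  obtain ⟨v, hv⟩ : ∃ v : ℝ≥0, (v : ℝ≥0∞) = volume A :=
    ⟨(volume A).toNNReal, ENNReal.coe_toNNReal h1⟩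
  have hv0 : v ≠ 0 := by rintro rfl; exact h0 (by simp [← hv])
  -- Densities are the constant `v⁻¹` on the two sets, so their geometric mean is `v⁻¹` as well.
  have hdens {S : Set (EuclideanSpace ℝ (Fin d))} (hS : MeasurableSet S) (hSv : volume S = v) :
      (volume.withDensity fun x => ((S.indicator (fun _ => v⁻¹) x : ℝ≥0) : ℝ≥0∞)) =
        uniformLaw d S := by
    have : (fun x => ((S.indicator (fun _ => v⁻¹) x : ℝ≥0) : ℝ≥0∞)) =
        S.indicator (fun _ => (volume S)⁻¹) := by
      funext x
      by_cases hx : x ∈ S <;> simp [hx, hSv, ENNReal.coe_inv hv0]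
    rw [this, withDensity_indicator hS, withDensity_const]
    rfl
  have hprobS {S : Set (EuclideanSpace ℝ (Fin d))} (hS : MeasurableSet S) (hSv : volume S = v) :
      ∫⁻ x, ((S.indicator (fun _ => v⁻¹) x : ℝ≥0) : ℝ≥0∞) = 1 := by
    have := isProbabilityMeasure_uniformLaw (A := S) (by simpa [hSv] using hv0) (by simp [hSv])
    have h := measure_univ (μ := uniformLaw d S)
    rwa [← hdens hS hSv, withDensity_apply _ .univ, Measure.restrict_univ] at h
  have hCv : volume C = v := hAC ▸ hv.symm
  obtain ⟨π, hπ0, hπ1, hπ⟩ := hasTransportInterpolation_euclideanSpace d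
    (A.indicator fun _ => v⁻¹) (C.indicator fun _ => v⁻¹) (measurable_const.indicator hA)
    (measurable_const.indicator hC) (hprobS hA hv.symm) (hprobS hC hCv)
  rw [hdens hA hv.symm] at hπ0
  rw [hdens hC hCv] at hπ1
  have hprob : IsProbabilityMeasure π := by
    have := isProbabilityMeasure_uniformLaw h0 h1
    refine ⟨?_⟩
    have h : π univ = (π.map Prod.fst) univ := by
      rw [Measure.map_apply measurable_fst .univ]; simp
    rw [h, hπ0, measure_univ]
  refine ⟨π, hprob, hπ0, hπ1, fun t ht => Measure.le_iff.2 fun S hS => ?_⟩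
  have hm : Measurable fun p : EuclideanSpace ℝ (Fin d) × EuclideanSpace ℝ (Fin d) =>
    (1 - t) • p.1 + t • p.2 := by fun_prop
  have hmA : ∀ᵐ p ∂π, p.1 ∈ A :=
    ae_of_ae_map measurable_fst.aemeasurable (hπ0 ▸ ae_mem_uniformLaw hA)
  have hmC : ∀ᵐ p ∂π, p.2 ∈ C :=
    ae_of_ae_map measurable_snd.aemeasurable (hπ1 ▸ ae_mem_uniformLaw hC)
  have key := hπ t ht (S.indicator 1) (measurable_one.indicator hS)
  rw [lintegral_indicator_one hS] at key
  have e : ∫⁻ p, S.indicator 1 ((1 - t) • p.1 + t • p.2) *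
      (((A.indicator (fun _ => v⁻¹) p.1) ^ (1 - t) *
        (C.indicator (fun _ => v⁻¹) p.2) ^ t)⁻¹ : ℝ≥0) ∂π =
      π.map (fun p => (1 - t) • p.1 + t • p.2) S * v := by
    rw [← lintegral_indicator_one hS, lintegral_map (measurable_one.indicator hS) hm,
      ← lintegral_mul_const' _ _ ENNReal.coe_ne_top]
    refine lintegral_congr_ae ?_
    filter_upwards [hmA, hmC] with p hpA hpC
    rw [indicator_of_mem hpA, indicator_of_mem hpC, ← NNReal.rpow_add (inv_ne_zero hv0)]
    simp
  rw [e] at key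
  rw [Measure.smul_apply, smul_eq_mul, ← hv, mul_comm]
  exact (ENNReal.le_div_iff_mul_le (by simp [hv0]) (by simp)).2 key

/-- The mean of a power of the distance to a random point of a centred ball grows with the
distance to the centre: it is rotation invariant and convex. -/
lemma integral_dist_pow_ball_mono (n : ℕ) {r : ℝ} (hr : 0 < r) {y y' : EuclideanSpace ℝ (Fin d)}
    (h : ‖y‖ ≤ ‖y'‖) :
    ∫ w, ‖y - w‖ ^ n ∂(uniformLaw d (Metric.closedBall 0 r)) ≤
      ∫ w, ‖y' - w‖ ^ n ∂(uniformLaw d (Metric.closedBall 0 r)) := by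
  set μ := uniformLaw d (Metric.closedBall 0 r) with hμ
  have hpr : IsProbabilityMeasure μ := isProbabilityMeasure_uniformLaw
    (Metric.measure_closedBall_pos _ _ hr).ne' measure_closedBall_lt_top.ne
  have hM : ∀ᵐ w ∂μ, ‖w‖ ≤ r := (ae_mem_uniformLaw Metric.isClosed_closedBall.measurableSet).mono
    fun w hw => by simpa using hw
  have hrot (a b : EuclideanSpace ℝ (Fin d)) (hab : ‖a‖ = ‖b‖) :
      ∫ w, ‖a - w‖ ^ n ∂μ = ∫ w, ‖b - w‖ ^ n ∂μ := by
    -- The reflection exchanging `a` and `b` preserves the ball.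
    set ρ := (ℝ ∙ (a - b))ᗮ.reflection with hρ
    have hρa : ρ a = b := Submodule.reflection_sub hab
    have hmap : MeasurePreserving ρ μ μ := by
      refine ⟨ρ.continuous.measurable, ?_⟩
      have := ρ.measurePreserving.restrict_preimage
        (s := Metric.closedBall 0 r) Metric.isClosed_closedBall.measurableSet
      rw [LinearIsometryEquiv.preimage_closedBall, map_zero] at this
      rw [hμ, uniformLaw, ProbabilityTheory.cond, Measure.map_smul, this.map_eq]
    conv_rhs => rw [← hmap.integral_comp ρ.toHomeomorph.measurableEmbedding]
    refine integral_congr_ae (Eventually.of_forall fun w => ?_)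
    simp only [← hρa, ← map_sub, LinearIsometryEquiv.norm_map]
  rcases (norm_nonneg y').eq_or_lt with h0 | h0
  · have : ‖y‖ = ‖y'‖ := le_antisymm h (h0 ▸ norm_nonneg y)
    exact (hrot _ _ this).le
  set s := ‖y‖ / ‖y'‖ with hs
  have hs0 : 0 ≤ s := by positivity
  have hs1 : s ≤ 1 := (div_le_one h0).2 h
  rw [hrot y (s • y') (by
    rw [norm_smul, Real.norm_of_nonneg hs0, hs, div_mul_cancel₀ _ h0.ne'])]
  have i (a : EuclideanSpace ℝ (Fin d)) : Integrable (fun w => ‖a - w‖ ^ n) μ :=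
    integrable_of_continuous_of_bounded hM (by fun_prop)
  -- `s • y'` lies on the segment from `-y'` to `y'`.
  have hle : ∫ w, ‖s • y' - w‖ ^ n ∂μ ≤
      ∫ w, ((1 + s) / 2 * ‖y' - w‖ ^ n + (1 - s) / 2 * ‖-y' - w‖ ^ n) ∂μ := by
    refine integral_mono (i _) (((i _).const_mul _).add ((i _).const_mul _)) fun w => ?_
    obtain ⟨-, hc⟩ := (convexOn_norm (E := EuclideanSpace ℝ (Fin d)) convex_univ).pow
      (fun x _ => norm_nonneg x) n
    have := hc (mem_univ (y' - w)) (mem_univ (-y' - w)) (a := (1 + s) / 2) (b := (1 - s) / 2)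
      (by linarith) (by linarith) (by ring)
    refine le_trans (le_of_eq ?_) this
    simp only [Pi.pow_apply]
    congr 2
    module
  rw [integral_add ((i _).const_mul _) ((i _).const_mul _), integral_const_mul,
    integral_const_mul, hrot (-y') y' (norm_neg _)] at hle
  linarith

/-- The Riesz rearrangement inequality for powers of the distance, with its equality case. -/
lemma meanDistPow_closedBall_le (k : ℕ) {r : ℝ} (hr : 0 < r)
    {K : Set (EuclideanSpace ℝ (Fin (k + 2)))} (hK : MeasurableSet K)
    (hKb : Bornology.IsBounded K) 
    (hvol : volume (Metric.closedBall (0 : EuclideanSpace ℝ (Fin (k + 2))) r) = volume K) :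
    meanDistPow (k + 2) (Metric.closedBall 0 r) ≤ meanDistPow (k + 2) K ∧
    (meanDistPow (k + 2) (Metric.closedBall 0 r) = meanDistPow (k + 2) K →
      ∃ c, K =ᵐ[volume] Metric.closedBall c r) := by
  set B : Set (EuclideanSpace ℝ (Fin (k + 2))) := Metric.closedBall 0 r with hB
  have hBm : MeasurableSet B := Metric.isClosed_closedBall.measurableSet
  have hB0 : volume B ≠ 0 := (Metric.measure_closedBall_pos _ _ hr).ne'
  have hB1 : volume B ≠ ∞ := measure_closedBall_lt_top.ne
  obtain ⟨π, hπ, hπ0, hπ1, hπt⟩ := exists_coupling_uniformLaw hBm hK hvol hB0 hB1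
  have : IsProbabilityMeasure (uniformLaw (k + 2) B) := isProbabilityMeasure_uniformLaw hB0 hB1
  have hmB : ∀ᵐ p ∂π, p.1 ∈ B :=
    ae_of_ae_map measurable_fst.aemeasurable (hπ0 ▸ ae_mem_uniformLaw hBm)
  have hmK : ∀ᵐ p ∂π, p.2 ∈ K :=
    ae_of_ae_map measurable_snd.aemeasurable (hπ1 ▸ ae_mem_uniformLaw hK)
  obtain ⟨M', hM'⟩ := hKb.exists_norm_le
  have hM : ∀ᵐ p ∂π, ‖p‖ ≤ max r M' := by
    filter_upwards [hmB, hmK] with p h1 h2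
    refine max_le_max ?_ (hM' _ h2)
    simpa [hB] using h1
  have hmBall : ∀ᵐ w ∂(uniformLaw (k + 2) B), ‖w‖ ≤ r :=
    (ae_mem_uniformLaw hBm).mono fun w hw => by simpa [hB] using hw
  have hMP : ∀ᵐ w ∂(π.prod π), ‖w‖ ≤ max r M' := by
    filter_upwards [Measure.quasiMeasurePreserving_fst.ae hM,
      Measure.quasiMeasurePreserving_snd.ae hM] with w h1 h2
    exact max_le h1 h2
  set u : EuclideanSpace ℝ (Fin (k + 2)) → ℝ :=
    fun y => ∫ w, ‖y - w‖ ^ (k + 2) ∂(uniformLaw (k + 2) B) with hu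
  have hum {y y' : EuclideanSpace ℝ (Fin (k + 2))} (h : ‖y‖ ≤ ‖y'‖) : u y ≤ u y' :=
    integral_dist_pow_ball_mono (k + 2) hr h
  have hcont : Continuous fun q : EuclideanSpace ℝ (Fin (k + 2)) × EuclideanSpace ℝ (Fin (k + 2)) =>
      ‖q.1 - q.2‖ ^ (k + 2) := by fun_prop
  have humeas : StronglyMeasurable u := hcont.stronglyMeasurable.integral_prod_right'
  -- Integrating out the second point turns a mean distance power into a mean of `u`.
  have fub {T : EuclideanSpace ℝ (Fin (k + 2)) × EuclideanSpace ℝ (Fin (k + 2)) →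
      EuclideanSpace ℝ (Fin (k + 2))} (hT : Continuous T) :
      ∫ w, ‖T w.1 - w.2.1‖ ^ (k + 2) ∂(π.prod π) = ∫ y, u y ∂(π.map T) := by
    rw [integral_map hT.measurable.aemeasurable humeas.aestronglyMeasurable,
      integral_prod _ (integrable_of_continuous_of_bounded hMP (by fun_prop))]
    refine integral_congr_ae (Eventually.of_forall fun p => ?_)
    simp only [hu]
    rw [← hπ0, integral_map measurable_fst.aemeasurable]
    exact Continuous.aestronglyMeasurable (by fun_prop)
  obtain ⟨e, he⟩ := exists_norm_eq (EuclideanSpace ℝ (Fin (k + 2))) hr.le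
  have uint {ν : Measure (EuclideanSpace ℝ (Fin (k + 2)))} [IsFiniteMeasure ν] {R : ℝ}
      (hR : ∀ᵐ x ∂ν, ‖x‖ ≤ R) (hR0 : 0 ≤ R) : Integrable u ν := by
    obtain ⟨b, hb⟩ := exists_norm_eq (EuclideanSpace ℝ (Fin (k + 2))) hR0
    refine Integrable.of_bound humeas.aestronglyMeasurable (u b) ?_
    filter_upwards [hR] with x hx
    rw [Real.norm_of_nonneg (integral_nonneg fun w => by positivity)]
    exact hum (hx.trans hb.ge)
  have hmean (q : EuclideanSpace ℝ (Fin (k + 2)) × EuclideanSpace ℝ (Fin (k + 2)) →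
      EuclideanSpace ℝ (Fin (k + 2))) (hq : Continuous q) (S : Set _)
      (hS : π.map q = uniformLaw (k + 2) S) :
      meanDistPow (k + 2) S = ∫ w, ‖q w.1 - q w.2‖ ^ (k + 2) ∂(π.prod π) := by
    rw [meanDistPow, ← hS, Measure.map_prod_map _ _ hq.measurable hq.measurable,
      integral_map (hq.measurable.prodMap hq.measurable).aemeasurable]
    · simp [dist_eq_norm]
    · exact Continuous.aestronglyMeasurable (by fun_prop)
  have main := integral_dist_pow_le_of_coupling k hM (fun t ht => by
    have hT : Continuous fun p : EuclideanSpace ℝ (Fin (k + 2)) × EuclideanSpace ℝ (Fin (k + 2)) =>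
      (1 - t) • p.1 + t • p.2 := by fun_prop
    rw [fub continuous_fst, fub hT, hπ0]
    have hpm := Measure.isProbabilityMeasure_map (μ := π) hT.measurable.aemeasurable
    refine integral_le_of_restrict_le hBm (ae_mem_uniformLaw hBm) ?_ (uint hmBall hr.le)
      (uint (R := max r M') ?_ (hr.le.trans (le_max_left _ _))) (c := u e) ?_ ?_
    · refine (Measure.restrict_mono_measure (hπt t ht) B).trans (le_of_eq ?_)
      rw [Measure.restrict_smul]
      rfl
    · rw [ae_map_iff hT.measurable.aemeasurable (measurableSet_le measurable_norm measurable_const)]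
      filter_upwards [hM] with p hp
      have h1 := (norm_fst_le p).trans hp
      have h2 := (norm_snd_le p).trans hp
      refine (norm_add_le _ _).trans ?_
      rw [norm_smul, norm_smul, Real.norm_of_nonneg ht.1.le,
        Real.norm_of_nonneg (by linarith [ht.2])]
      nlinarith [ht.1, ht.2]
    · intro x hx
      exact hum (he ▸ by simpa [hB] using hx)
    · intro x hx
      exact hum (he ▸ by simpa [hB] using (not_le.1 (by simpa [hB] using hx)).le))
  rw [hmean Prod.fst continuous_fst B hπ0, hmean Prod.snd continuous_snd K hπ1]
  refine ⟨main.1, fun heq => ?_⟩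
  -- The displacement of the coupling is constant, so `K` is a translate of `B`.
  have hae := main.2 heq
  obtain ⟨p', hp'⟩ : ∃ p' : EuclideanSpace ℝ (Fin (k + 2)) × EuclideanSpace ℝ (Fin (k + 2)),
      ∀ᵐ p ∂π, p.1 - p'.1 = p.2 - p'.2 := by
    have hs := (Measure.measurePreserving_swap (μ := π) (ν := π)).quasiMeasurePreserving.ae hae
    exact ((Measure.ae_ae_of_ae_prod hs).mono fun p' h => h.mono fun p hp => hp).exists
  set c := p'.2 - p'.1 with hc
  refine ⟨c, ?_⟩
  have hKc : ∀ᵐ x ∂(uniformLaw (k + 2) K), x ∈ Metric.closedBall c r := by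
    rw [← hπ1]
    refine (ae_map_iff (p := fun x => x ∈ Metric.closedBall c r) measurable_snd.aemeasurable
      (Metric.isClosed_closedBall (x := c) (ε := r)).measurableSet).2 ?_
    filter_upwards [hp', hmB] with p h1 h2
    have : p.2 - c = p.1 := by
      rw [hc, sub_sub_eq_add_sub, add_sub_right_comm, ← h1, sub_add_cancel]
    rw [mem_closedBall_iff_norm, this]
    simpa [hB] using h2
  have hsub : K ≤ᵐ[volume] Metric.closedBall c r := by
    have : ∀ᵐ x ∂(volume.restrict K), x ∈ Metric.closedBall c r := by
      have h := (Measure.ae_ennreal_smul_measure_iff (c := (volume K)⁻¹)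
        (ENNReal.inv_ne_zero.2 (hvol ▸ hB1))).1 hKc
      exact h
    exact (ae_restrict_iff' hK).1 this
  refine ae_eq_of_ae_subset_of_measure_ge hsub ?_ hK.nullMeasurableSet measure_closedBall_lt_top.ne
  rw [← hvol, hB, EuclideanSpace.volume_closedBall, EuclideanSpace.volume_closedBall]

end UniformLaw

/-! ### Elongation of balls and of convex sets -/

section Balls

open scoped Pointwise

variable {d : ℕ}

lemma elongationRho_pos (hd : 1 ≤ d) : 0 < elongationRho d := by
  have h : (0 : ℝ) < d := by exact_mod_cast hd
  have h1 := Real.Gamma_pos_of_pos h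
  have h2 := Real.Gamma_pos_of_pos (by positivity : (0 : ℝ) < ((d : ℝ) + 1) / 2)
  have h3 := Real.Gamma_pos_of_pos (by positivity : (0 : ℝ) < (d : ℝ) + 1 / 2)
  unfold elongationRho
  positivity

/-- The elongation is invariant under translations and dilations of a ball. -/
lemma elongation_closedBall (c : EuclideanSpace ℝ (Fin d)) {r : ℝ} (hr : 0 < r) :
    elongation d (Metric.closedBall c r) = elongation d (Metric.closedBall 0 1) := by
  set B : Set (EuclideanSpace ℝ (Fin d)) := Metric.closedBall 0 1 with hB
  set T : EuclideanSpace ℝ (Fin d) → EuclideanSpace ℝ (Fin d) := fun x => c + r • x with hT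
  have hTm : Measurable T := by fun_prop
  have himage (S : Set (EuclideanSpace ℝ (Fin d))) :
      volume (T '' S) = ENNReal.ofReal (r ^ d) * volume S := by
    have : T '' S = (fun x => c + x) '' (r • S) := by
      rw [← image_smul, image_image]
    rw [this, image_add_left, measure_preimage_add, Measure.addHaar_smul,
      finrank_euclideanSpace_fin, abs_of_pos (by positivity)]
  have hball : Metric.closedBall c r = T '' B := by
    have : T '' B = (fun x => c + x) '' (r • B) := by
      rw [← image_smul, image_image]
    rw [this, hB, smul_closedBall _ _ zero_le_one, image_add_left, preimage_add_closedBall]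
    simp [abs_of_pos hr]
  have hrd : 0 < r ^ d := by positivity
  have hrd0 : ENNReal.ofReal (r ^ d) ≠ 0 := by simpa using hrd
  have hlaw : uniformLaw d (Metric.closedBall c r) = (uniformLaw d B).map T := by
    refine Measure.ext fun S hS => ?_
    rw [Measure.map_apply hTm hS, uniformLaw, uniformLaw, cond_apply' hS,
      cond_apply' (hTm hS), hball, himage, ← image_inter_preimage, himage,
      ENNReal.mul_inv (Or.inl hrd0) (Or.inl ENNReal.ofReal_ne_top), mul_mul_mul_comm,
      ENNReal.inv_mul_cancel hrd0 ENNReal.ofReal_ne_top, one_mul]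
  have hmean : meanDistPow d (Metric.closedBall c r) = r ^ d * meanDistPow d B := by
    have := isProbabilityMeasure_uniformLaw (A := B)
      (Metric.measure_closedBall_pos _ _ one_pos).ne' measure_closedBall_lt_top.ne
    rw [meanDistPow, meanDistPow, hlaw, Measure.map_prod_map _ _ hTm hTm,
      integral_map (hTm.prodMap hTm).aemeasurable, ← integral_const_mul]
    · refine integral_congr_ae (Eventually.of_forall fun p => ?_)
      simp only [hT, Prod.map, dist_add_left, dist_smul₀, Real.norm_of_nonneg hr.le, mul_pow]
    · exact Continuous.aestronglyMeasurable (by fun_prop)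
  rw [elongation, elongation, hmean, measureReal_def, measureReal_def, hball, himage,
    ENNReal.toReal_mul, ENNReal.toReal_ofReal hrd.le, mul_div_mul_left _ _ hrd.ne']

lemma exists_closedBall_volume_eq (hd : 1 ≤ d) {v : ℝ≥0∞} (h0 : v ≠ 0) (h1 : v ≠ ∞) :
    ∃ r : ℝ, 0 < r ∧ volume (Metric.closedBall (0 : EuclideanSpace ℝ (Fin d)) r) = v := by
  set b := volume (Metric.ball (0 : EuclideanSpace ℝ (Fin d)) 1) with hb
  have hb0 : b ≠ 0 := (Metric.measure_ball_pos _ _ one_pos).ne'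
  have hb1 : b ≠ ∞ := measure_ball_lt_top.ne
  have hvb0 : v / b ≠ 0 := ENNReal.div_ne_zero.2 ⟨h0, hb1⟩
  have hvb1 : v / b ≠ ∞ := ENNReal.div_ne_top h1 hb0
  have hpos : 0 < (v / b).toReal := ENNReal.toReal_pos hvb0 hvb1
  have hd0 : d ≠ 0 := by omega
  refine ⟨(v / b).toReal ^ ((d : ℝ)⁻¹), Real.rpow_pos_of_pos hpos _, ?_⟩
  rw [Measure.addHaar_closedBall _ _ (Real.rpow_nonneg hpos.le _), finrank_euclideanSpace_fin,
    Real.rpow_inv_natCast_pow hpos.le hd0, ENNReal.ofReal_toReal hvb1,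
    ENNReal.div_mul_cancel hb0 hb1]

lemma closure_eq_closedBall_of_ae_eq {K : Set (EuclideanSpace ℝ (Fin d))} (hK : Convex ℝ K)
    (hKi : (interior K).Nonempty) {c : EuclideanSpace ℝ (Fin d)} {r : ℝ} (hr : 0 < r)
    (h : K =ᵐ[volume] Metric.closedBall c r) : closure K = Metric.closedBall c r := by
  refine subset_antisymm ?_ ?_
  · rw [← hK.closure_interior_eq_closure_of_nonempty_interior hKi]
    refine closure_minimal ?_ Metric.isClosed_closedBall
    have hopen : IsOpen (interior K \ Metric.closedBall c r) :=
      isOpen_interior.sdiff Metric.isClosed_closedBall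
    have hz : volume (interior K \ Metric.closedBall c r) = 0 :=
      measure_mono_null (sdiff_subset_sdiff_left interior_subset) (ae_le_set.1 h.le)
    exact sdiff_eq_empty.1 (hopen.eq_empty_of_measure_zero hz)
  · rw [← closure_ball c hr.ne']
    refine closure_minimal ?_ isClosed_closure
    have hopen : IsOpen (Metric.ball c r \ closure K) := Metric.isOpen_ball.sdiff isClosed_closure
    have hz : volume (Metric.ball c r \ closure K) = 0 :=
      measure_mono_null (sdiff_subset_sdiff Metric.ball_subset_closedBall subset_closure)
        (ae_le_set.1 h.symm.le)
    exact sdiff_eq_empty.1 (hopen.eq_empty_of_measure_zero hz)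

/-- On the line the admissible sets are the bounded nondegenerate intervals. -/
lemma exists_closure_eq_closedBall_of_dim_one {K : Set (EuclideanSpace ℝ (Fin 1))}
    (hK : K ∈ ConvexBoundedSets 1) :
    ∃ (c : EuclideanSpace ℝ (Fin 1)) (r : ℝ), 0 < r ∧ closure K = Metric.closedBall c r := by
  obtain ⟨hconv, hbdd, hint⟩ := hK
  set e := (OrthonormalBasis.singleton (Fin 1) ℝ).repr with he
  have hcomp : IsCompact (e.symm '' closure K) :=
    hbdd.isCompact_closure.image e.symm.continuous
  have hconn : IsConnected (e.symm '' closure K) :=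
    ⟨((hint.mono interior_subset).closure).image _,
      hconv.closure.isPreconnected.image _ e.symm.continuous.continuousOn⟩
  have hIcc := eq_Icc_of_connected_compact hconn hcomp
  rw [Real.Icc_eq_closedBall] at hIcc
  have hball := congrArg (fun s => e '' s) hIcc
  simp only [image_image, LinearIsometryEquiv.apply_symm_apply, image_id',
    LinearIsometryEquiv.image_closedBall] at hball
  refine ⟨_, _, ?_, hball⟩
  by_contra! hr
  have hsub : interior K ⊆ interior {e ((sInf (e.symm '' closure K) +
      sSup (e.symm '' closure K)) / 2)} := by
    refine interior_mono (subset_closure.trans (hball.subset.trans ?_))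
    intro x hx
    exact dist_le_zero.1 (hx.trans hr)
  rw [interior_singleton] at hsub
  exact hint.ne_empty (subset_empty_iff.1 hsub)

lemma ae_eq_closure_of_convex {K : Set (EuclideanSpace ℝ (Fin d))} (hK : Convex ℝ K) :
    closure K =ᵐ[volume] K :=
  closure_ae_eq_of_null_frontier (hK.addHaar_frontier volume)

/-- In dimension at least two, balls minimize the elongation, and they are the only minimizers. -/
lemma elongation_closedBall_le (hd : 2 ≤ d) {K : Set (EuclideanSpace ℝ (Fin d))}
    (hK : K ∈ ConvexBoundedSets d) :
    elongation d (Metric.closedBall 0 1) ≤ elongation d K ∧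
    (elongation d (Metric.closedBall 0 1) = elongation d K →
      ∃ (c : EuclideanSpace ℝ (Fin d)) (r : ℝ), 0 < r ∧ closure K = Metric.closedBall c r) := by
  obtain ⟨hconv, hbdd, hint⟩ := hK
  obtain ⟨k, rfl⟩ := Nat.exists_eq_add_of_le' hd
  have hae := ae_eq_closure_of_convex hconv
  have hv0 : volume (closure K) ≠ 0 := (Measure.measure_pos_of_nonempty_interior _
    (hint.mono (interior_mono subset_closure))).ne'
  have hv1 : volume (closure K) ≠ ∞ := hbdd.closure.measure_lt_top.ne
  obtain ⟨r, hr, hvol⟩ := exists_closedBall_volume_eq (by omega : 1 ≤ k + 2) hv0 hv1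
  obtain ⟨hle, heq⟩ := meanDistPow_closedBall_le k hr isClosed_closure.measurableSet
    hbdd.closure hvol
  have hρ := elongationRho_pos (by omega : 1 ≤ k + 2)
  have hv : 0 < volume.real (closure K) := ENNReal.toReal_pos hv0 hv1
  have hvr : volume.real (Metric.closedBall (0 : EuclideanSpace ℝ (Fin (k + 2))) r) =
    volume.real (closure K) := by rw [measureReal_def, measureReal_def, hvol]
  rw [← elongation_closedBall 0 hr, ← elongation_congr hae, elongation, elongation, hvr]
  refine ⟨by gcongr, fun h => ?_⟩
  have h' := (div_left_inj' hv.ne').1 (mul_left_cancel₀ (by positivity) h)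
  obtain ⟨c, hc⟩ := heq h'
  exact ⟨c, r, hr, closure_eq_closedBall_of_ae_eq hconv hint hr (hae.symm.trans hc)⟩

end Balls

theorem proposition1 (d : ℕ) (hd : 1 ≤ d) (K : Set (EuclideanSpace ℝ (Fin d)))
    (hK : K ∈ ConvexBoundedSets d) :
    (∀ L ∈ ConvexBoundedSets d, elongation d K ≤ elongation d L) ↔
      ∃ (c : EuclideanSpace ℝ (Fin d)) (r : ℝ), 0 < r ∧ closure K = Metric.closedBall c r := by
  have hball {L : Set (EuclideanSpace ℝ (Fin d))} (hL : L ∈ ConvexBoundedSets d)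
      (h : ∃ (c : EuclideanSpace ℝ (Fin d)) (r : ℝ), 0 < r ∧ closure L = Metric.closedBall c r) :
      elongation d L = elongation d (Metric.closedBall 0 1) := by
    obtain ⟨c, r, hr, hc⟩ := h
    rw [← elongation_congr (ae_eq_closure_of_convex hL.1), hc, elongation_closedBall c hr]
  rcases hd.eq_or_lt with rfl | hd2
  · refine ⟨fun _ => exists_closure_eq_closedBall_of_dim_one hK, fun h L hL => ?_⟩
    rw [hball hK h, hball hL (exists_closure_eq_closedBall_of_dim_one hL)]
  · refine ⟨fun h => ?_, fun h L hL => ?_⟩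
    · have hunit : Metric.closedBall 0 1 ∈ ConvexBoundedSets d :=
        ⟨convex_closedBall _ _, Metric.isBounded_closedBall,
          (Metric.nonempty_ball.2 one_pos).mono Metric.ball_subset_interior_closedBall⟩
      obtain ⟨hle, heq⟩ := elongation_closedBall_le hd2 hK
      exact heq (le_antisymm hle (h _ hunit))
    · rw [hball hK h]
      exact (elongation_closedBall_le hd2 hL).1
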